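/- Let $(\mathcal X,\mathcal S)$ be a measurable space and let $\mathcal F$ be a family of measurable functions $f:\mathcal X\to\mathbb R$ with a measurable envelope $F:\mathcal X\to[0,\infty)$, that is, $|f(x)|\le F(x)$ for all $x\in\mathcal X$ and $f\in\mathcal F$. Assume that $\mathcal F$ is separable: there is a countable subfamily $\mathcal F_0\subseteq\mathcal F$ such that every $f\in\mathcal F$ is the pointwise limit of a sequence of functions in $\mathcal F_0$. For $f\in\mathcal F$ let $$G_f=\{(x,s)\in\mathcal X\times\mathbb R:\ 0\le s\le f(x)\ \text{ or }\ f(x)\le s\le 0\},\qquad \mathcal G(\mathcal F)=\{G_f:f\in\mathcal F\}.$$ Suppose that $\mathcal G(\mathcal F)$ has finite Vapnik-Chervonenkis dimension, that is, there is an upper bound on the cardinality of the finite sets $D\subseteq\mathcal X\times\mathbb R$ all of whose subsets are of the form $G\cap D$ with $G\in\mathcal G(\mathcal F)$. If $\mu$ is any probability measure on $(\mathcal X,\mathcal S)$ such that $\int F\,d\mu<\infty$, then for every $\epsilon>0$ the bracketing number $N_{[\,]}(\epsilon,\mathcal F,\mu)$ is finite: there are finitely many pairs of measurable functions $g_i\le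 h_i$ from $\mathcal X$ to $\mathbb R$, $i=1,\dots,N$, with $\int(h_i-g_i)\,d\mu\le\epsilon$, such that every $f\in\mathcal F$ satisfies $g_i\le f\le h_i$ pointwise on $\mathcal X$ for some $i$. -/

import Mathlib

namespace VCGraph

/-- The family `𝒞` shatters the finite set `D` if every subset of `D` has the form `C ∩ D` with
`C ∈ 𝒞`. -/
def Shatters {α : Type*} (𝒞 : Set (Set α)) (D : Finset α) : Prop :=
  ∀ E : Set α, E ⊆ (D : Set α) → ∃ C ∈ 𝒞, C ∩ (D : Set α) = E

/-- The Vapnik-Chervonenkis dimension of a family of sets: the largest cardinality of a finite set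
shattered by `𝒞`, and `⊤` if `𝒞` shatters arbitrarily large finite sets. -/
noncomputable def vcDim {α : Type*} (𝒞 : Set (Set α)) : ℕ∞ :=
  ⨆ (D : Finset α) (_ : Shatters 𝒞 D), (D.card : ℕ∞)

/-- The region between the horizontal axis and the function `f` (the "graph" of `f`). -/
def graph {X : Type*} (f : X → ℝ) : Set (X × ℝ) :=
  {p | (0 ≤ p.2 ∧ p.2 ≤ f p.1) ∨ (f p.1 ≤ p.2 ∧ p.2 ≤ 0)}

/-- The family of graphs of the functions in `F`. -/
def graphs {X : Type*} (F : Set (X → ℝ)) : Set (Set (X × ℝ)) :=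
  graph '' F

/-- `G : X → [0, ∞)` is a (measurable) envelope of the family `F`. -/
structure IsEnvelope {X : Type*} [MeasurableSpace X] (G : X → ℝ) (F : Set (X → ℝ)) : Prop where
  measurable : Measurable G
  nonneg : ∀ x, 0 ≤ G x
  abs_le : ∀ f ∈ F, ∀ x, |f x| ≤ G x

/-- The family `F` is separable: there is a countable subfamily `F₀` such that each member of `F`
is the pointwise limit of a sequence in `F₀`. -/
def IsSeparableFamily {X : Type*} (F : Set (X → ℝ)) : Prop :=
  ∃ F₀ : Set (X → ℝ), F₀ ⊆ F ∧ F₀.Countable ∧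
    ∀ f ∈ F, ∃ u : ℕ → X → ℝ, (∀ n, u n ∈ F₀) ∧
      ∀ x, Filter.Tendsto (fun n => u n x) Filter.atTop (nhds (f x))

/-- The bracket `[g, h]`: all measurable functions lying between `g` and `h` at every point. -/
def bracket {X : Type*} [MeasurableSpace X] (g h : X → ℝ) : Set (X → ℝ) :=
  {f | Measurable f ∧ ∀ x, g x ≤ f x ∧ f x ≤ h x}

/-- The pair `g ≤ h` of measurable functions determines an `ε`-bracket with respect to `μ`. As
`h - g` is non-negative, its integral is taken as a (possibly infinite) Lebesgue integral. -/
structure IsEpsBracket {X : Type*} [MeasurableSpace X] (μ : MeasureTheory.Measure X) (ε : ℝ)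
    (g h : X → ℝ) : Prop where
  measurable_left : Measurable g
  measurable_right : Measurable h
  le : ∀ x, g x ≤ h x
  lintegral_le : ∫⁻ x, ENNReal.ofReal (h x - g x) ∂μ ≤ ENNReal.ofReal ε

/-- The set `Θ` of pairs `(g, h)` consists of `ε`-brackets `[g, h]`, which together cover `F`. -/
def IsBracketCover {X : Type*} [MeasurableSpace X] (μ : MeasureTheory.Measure X) (ε : ℝ)
    (F : Set (X → ℝ)) (Θ : Set ((X → ℝ) × (X → ℝ))) : Prop :=
  (∀ p ∈ Θ, IsEpsBracket μ ε p.1 p.2) ∧ ∀ f ∈ F, ∃ p ∈ Θ, f ∈ bracket p.1 p.2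

/-- The bracketing number: the least number of `ε`-brackets needed to cover `F`, with value `⊤` if
no finite number suffices. -/
noncomputable def bracketingNumber {X : Type*} [MeasurableSpace X] (ε : ℝ) (F : Set (X → ℝ))
    (μ : MeasureTheory.Measure X) : ℕ∞ :=
  ⨅ (Θ : Set ((X → ℝ) × (X → ℝ))) (_ : IsBracketCover μ ε F Θ), Θ.encard

end VCGraph

namespace VCGraph

open MeasureTheory Filter Set
open scoped ENNReal

/-- If all Boolean patterns of every finite length are realised by sequences in `𝒞`, then `𝒞` has
infinite Vapnik-Chervonenkis dimension. -/
theorem vcDim_eq_top_of_independent {α ι : Type*} (𝒞 : Set (Set α)) (C : ι → Set α)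
    (hC : ∀ i, C i ∈ 𝒞)
    (h : ∀ m : ℕ, ∃ c : Fin m → ι, ∀ σ : Fin m → Bool, ∃ y, ∀ j, y ∈ C (c j) ↔ σ j = true) :
    vcDim 𝒞 = ⊤ := by
  classical
  refine ENat.eq_top_iff_forall_ge.2 fun d => ?_
  obtain ⟨c, hc⟩ := h (Fintype.card (Finset (Fin d)))
  let e := Fintype.equivFin (Finset (Fin d))
  choose y hy using hc
  let x : Fin d → α := fun k => y fun j => decide (k ∈ e.symm j)
  have hx : ∀ k s, x k ∈ C (c (e s)) ↔ k ∈ s := fun k s => by simp [x, hy]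
  have hinj : Function.Injective x := fun k l hkl => by
    have h1 := (hx k {k}).2 (by simp)
    rw [hkl, hx] at h1
    exact (Finset.mem_singleton.1 h1).symm
  have hsh : Shatters 𝒞 (Finset.univ.map ⟨x, hinj⟩) := by
    intro E hE
    refine ⟨_, hC (c (e (Finset.univ.filter fun k => x k ∈ E))), ?_⟩
    ext z
    constructor
    · rintro ⟨hz, hz'⟩
      simp only [Finset.coe_map, Function.Embedding.coeFn_mk, Finset.coe_univ, image_univ,
        mem_range] at hz'
      obtain ⟨k, rfl⟩ := hz'
      simpa using (hx _ _).1 hz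
    · intro hz
      refine ⟨?_, hE hz⟩
      have hz' := hE hz
      simp only [Finset.coe_map, Function.Embedding.coeFn_mk, Finset.coe_univ, image_univ,
        mem_range] at hz'
      obtain ⟨k, rfl⟩ := hz'
      exact (hx _ _).2 (by simpa using hz)
  have := le_iSup₂_of_le (f := fun (D : Finset α) (_ : Shatters 𝒞 D) => (D.card : ℕ∞)) _ hsh le_rfl
  simpa [vcDim] using this

/-- If every set of positive measure inside `S` is split, in measure, by almost all members of a
family along a filter, then all Boolean patterns of every length are realised. -/
theorem exists_independent_of_split {Y ι : Type*} [MeasurableSpace Y] (ν : Measure Y)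
    (C : ι → Set Y) (hC : ∀ i, MeasurableSet (C i)) (l : Filter ι) [l.NeBot] (S : Set Y)
    (hS : MeasurableSet S) (hS0 : ν S ≠ 0)
    (hsplit : ∀ B ⊆ S, MeasurableSet B → ν B ≠ 0 → ∀ᶠ i in l, ν (C i ∩ B) ≠ 0 ∧ ν (B \ C i) ≠ 0)
    (m : ℕ) : ∃ c : Fin m → ι, ∀ σ : Fin m → Bool,
      ν (S ∩ {y | ∀ j, y ∈ C (c j) ↔ σ j = true}) ≠ 0 := by
  induction m with
  | zero => exact ⟨Fin.elim0, fun σ => by simpa using hS0⟩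
  | succ m ih =>
    obtain ⟨c, hc⟩ := ih
    have hmeas : ∀ σ : Fin m → Bool,
        MeasurableSet (S ∩ {y | ∀ j, y ∈ C (c j) ↔ σ j = true}) := fun σ => by
      refine hS.inter ?_
      rw [ofPred_forall]
      exact MeasurableSet.iInter fun j => (hC (c j)).iff (MeasurableSet.const _)
    obtain ⟨i, hi⟩ := (eventually_all.2 fun σ : Fin m → Bool =>
      hsplit _ inter_subset_left (hmeas σ) (hc σ)).exists
    refine ⟨Fin.cons i c, fun σ => ?_⟩
    have hi' := hi (Fin.tail σ)
    cases h0 : σ 0 with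
    | true =>
      convert hi'.1 using 2
      ext y
      simp only [Fin.forall_fin_succ, mem_inter_iff, mem_ofPred_eq, Fin.cons_zero, Fin.cons_succ,
        h0, Fin.tail]
      tauto
    | false =>
      convert hi'.2 using 2
      ext y
      simp only [Fin.forall_fin_succ, mem_inter_iff, mem_ofPred_eq, Fin.cons_zero, Fin.cons_succ,
        h0, Fin.tail, Set.mem_sdiff]
      simp
      tauto

/-- A family of sets that is closed under finite unions contains a sequence exhausting, up to null
sets, all of its members. -/
theorem exists_exhausting_seq {Y : Type*} [MeasurableSpace Y] (ν : Measure Y) [IsFiniteMeasure ν]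
    (p : Set Y → Prop) (hp0 : p ∅) (hpm : ∀ A, p A → MeasurableSet A)
    (hpU : ∀ A B, p A → p B → p (A ∪ B)) :
    ∃ A : ℕ → Set Y, (∀ n, p (A n)) ∧ Monotone A ∧ ∀ B, p B → ν (B \ ⋃ n, A n) = 0 := by
  obtain ⟨u, -, hu, hup⟩ := exists_seq_tendsto_sSup (S := ν '' {A | p A}) ⟨_, ∅, hp0, rfl⟩
    (OrderTop.bddAbove _)
  choose A hA hAu using hup
  have hacc : ∀ n, p (accumulate A n) := fun n => by
    induction n with
    | zero => simpa using hA 0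
    | succ n ih => rw [accumulate_succ]; exact hpU _ _ ih (hA _)
  refine ⟨accumulate A, hacc, monotone_accumulate, fun B hB => ?_⟩
  rw [iUnion_accumulate]
  have hle : ∀ n, ν (B \ ⋃ n, A n) + u n ≤ sSup (ν '' {A | p A}) := fun n => by
    refine le_trans ?_ (le_sSup ⟨B ∪ A n, hpU _ _ hB (hA n), rfl⟩)
    rw [← hAu n, ← measure_union (disjoint_sdiff_left.mono_right (subset_iUnion A n))
      (hpm _ (hA n))]
    exact measure_mono (union_subset_union_left _ sdiff_subset)
  have hlim := le_of_tendsto' (hu.const_add (ν (B \ ⋃ n, A n))) hle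
  have hfin : sSup (ν '' {A | p A}) ≠ ∞ := by
    refine ne_top_of_le_ne_top (measure_ne_top ν univ) (sSup_le ?_)
    rintro _ ⟨A, -, rfl⟩
    exact measure_mono (subset_univ _)
  by_contra hne
  exact (ENNReal.lt_add_right hfin hne).not_ge (by rwa [add_comm])

/-- The sets with index in `s` are covered by finitely many measurable brackets of sets, each of
measure at most `ε`. -/
def FinitelyBracketed {Y ι : Type*} [MeasurableSpace Y] (ν : Measure Y) (ε : ℝ≥0∞)
    (C : ι → Set Y) (s : Set ι) : Prop :=
  ∃ T : Set (Set Y × Set Y), T.Finite ∧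
    (∀ p ∈ T, MeasurableSet p.1 ∧ MeasurableSet p.2 ∧ p.1 ⊆ p.2 ∧ ν (p.2 \ p.1) ≤ ε) ∧
    ∀ i ∈ s, ∃ p ∈ T, p.1 ⊆ C i ∧ C i ⊆ p.2

theorem FinitelyBracketed.union {Y ι : Type*} [MeasurableSpace Y] {ν : Measure Y} {ε : ℝ≥0∞}
    {C : ι → Set Y} {s t : Set ι} (hs : FinitelyBracketed ν ε C s)
    (ht : FinitelyBracketed ν ε C t) : FinitelyBracketed ν ε C (s ∪ t) := by
  obtain ⟨T, hT, hT1, hT2⟩ := hs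
  obtain ⟨T', hT', hT1', hT2'⟩ := ht
  refine ⟨T ∪ T', hT.union hT', fun p hp => hp.elim (hT1 p) (hT1' p), fun i hi => ?_⟩
  rcases hi with hi | hi
  · obtain ⟨p, hp, h⟩ := hT2 i hi
    exact ⟨p, Or.inl hp, h⟩
  · obtain ⟨p, hp, h⟩ := hT2' i hi
    exact ⟨p, Or.inr hp, h⟩

theorem FinitelyBracketed.mono {Y ι : Type*} [MeasurableSpace Y] {ν : Measure Y} {ε : ℝ≥0∞}
    {C : ι → Set Y} {s t : Set ι} (ht : FinitelyBracketed ν ε C t) (hst : s ⊆ t) :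
    FinitelyBracketed ν ε C s := by
  obtain ⟨T, hT, hT1, hT2⟩ := ht
  exact ⟨T, hT, hT1, fun i hi => hT2 i (hst hi)⟩

theorem finitelyBracketed_empty {Y ι : Type*} [MeasurableSpace Y] (ν : Measure Y) (ε : ℝ≥0∞)
    (C : ι → Set Y) : FinitelyBracketed ν ε C ∅ :=
  ⟨∅, finite_empty, by simp, by simp⟩

/-- The sets that almost avoid `A₀` and almost contain `A₁` lie in a single bracket, if `A₀ ∪ A₁`
has almost full measure. -/
theorem finitelyBracketed_of_null {Y ι : Type*} [MeasurableSpace Y] [Countable ι] (ν : Measure Y)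
    (ε : ℝ≥0∞) (C : ι → Set Y) (hC : ∀ i, MeasurableSet (C i)) (A₀ A₁ : Set Y)
    (h₀ : MeasurableSet A₀) (h₁ : MeasurableSet A₁) (hε : ν (A₀ ∪ A₁)ᶜ ≤ ε) :
    FinitelyBracketed ν ε C {i | ν (C i ∩ A₀) = 0 ∧ ν (A₁ \ C i) = 0} := by
  set s := {i | ν (C i ∩ A₀) = 0 ∧ ν (A₁ \ C i) = 0} with hs
  rcases s.eq_empty_or_nonempty with h | ⟨i₀, hi₀⟩
  · rw [h]; exact finitelyBracketed_empty ν ε C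
  set N₀ : Set Y := ⋃ i ∈ s, C i ∩ A₀ with hN₀
  set N₁ : Set Y := ⋃ i ∈ s, A₁ \ C i with hN₁
  have m₀ : MeasurableSet N₀ :=
    MeasurableSet.biUnion s.to_countable fun i _ => (hC i).inter h₀
  have m₁ : MeasurableSet N₁ :=
    MeasurableSet.biUnion s.to_countable fun i _ => h₁.diff (hC i)
  have n₀ : ν N₀ = 0 := (measure_biUnion_null_iff s.to_countable).2 fun i hi => hi.1
  have n₁ : ν N₁ = 0 := (measure_biUnion_null_iff s.to_countable).2 fun i hi => hi.2
  have hcov : ∀ i ∈ s, A₁ \ N₁ ⊆ C i ∧ C i ⊆ A₀ᶜ ∪ N₀ := by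
    refine fun i hi => ⟨fun y hy => ?_, fun y hy => ?_⟩
    · by_contra hyC
      exact hy.2 (mem_biUnion hi ⟨hy.1, hyC⟩)
    · by_cases hyA : y ∈ A₀
      · exact Or.inr (mem_biUnion hi ⟨hy, hyA⟩)
      · exact Or.inl hyA
  refine ⟨{(A₁ \ N₁, A₀ᶜ ∪ N₀)}, finite_singleton _, ?_, fun i hi => ⟨_, rfl, hcov i hi⟩⟩
  rintro p rfl
  refine ⟨h₁.diff m₁, h₀.compl.union m₀, (hcov i₀ hi₀).1.trans (hcov i₀ hi₀).2, ?_⟩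
  calc ν ((A₀ᶜ ∪ N₀) \ (A₁ \ N₁)) ≤ ν ((A₀ ∪ A₁)ᶜ ∪ (N₀ ∪ N₁)) := by
        refine measure_mono fun y hy => ?_
        simp only [Set.mem_sdiff, mem_union, mem_compl_iff] at hy ⊢
        tauto
    _ ≤ ν (A₀ ∪ A₁)ᶜ + (ν N₀ + ν N₁) :=
        (measure_union_le _ _).trans (add_le_add_right (measure_union_le _ _) _)
    _ ≤ ε := by simpa [n₀, n₁] using hε

/-- A countable family of measurable sets of finite Vapnik-Chervonenkis dimension is covered by
finitely many brackets of small measure. -/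
theorem finitelyBracketed_of_vcDim_lt_top {Y ι : Type*} [MeasurableSpace Y] [Countable ι]
    (ν : Measure Y) [IsFiniteMeasure ν] (ε : ℝ≥0∞) (hε : ε ≠ 0) (C : ι → Set Y)
    (hC : ∀ i, MeasurableSet (C i)) (𝒞 : Set (Set Y)) (hC𝒞 : ∀ i, C i ∈ 𝒞) (hdim : vcDim 𝒞 < ⊤) :
    FinitelyBracketed ν ε C univ := by
  by_contra hnot
  let l : Filter ι := Filter.comk (FinitelyBracketed ν ε C) (finitelyBracketed_empty ν ε C)
    (fun t ht s hst => ht.mono hst) (fun s hs t ht => hs.union ht)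
  have hl : l.NeBot := ⟨fun h => hnot <| by
    have : (∅ : Set ι) ∈ l := by rw [h]; exact mem_bot
    rwa [Filter.mem_comk, compl_empty] at this⟩
  let 𝓤 := Ultrafilter.of l
  have hsmall : ∀ s : Set ι, FinitelyBracketed ν ε C s → s ∉ 𝓤 := fun s hs hs𝓤 => by
    have : sᶜ ∈ 𝓤 := Ultrafilter.of_le l (by rwa [Filter.mem_comk, compl_compl])
    exact Ultrafilter.compl_notMem_iff.2 hs𝓤 this
  obtain ⟨A₀, hA₀, mono₀, ex₀⟩ := exists_exhausting_seq ν
    (fun A => MeasurableSet A ∧ ∀ᶠ i in (𝓤 : Filter ι), ν (C i ∩ A) = 0) (by simp)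
    (fun A h => h.1) (fun A B hA hB => ⟨hA.1.union hB.1, by
      filter_upwards [hA.2, hB.2] with i h1 h2
      rw [inter_union_distrib_left]
      exact measure_union_null h1 h2⟩)
  obtain ⟨A₁, hA₁, mono₁, ex₁⟩ := exists_exhausting_seq ν
    (fun A => MeasurableSet A ∧ ∀ᶠ i in (𝓤 : Filter ι), ν (A \ C i) = 0) (by simp)
    (fun A h => h.1) (fun A B hA hB => ⟨hA.1.union hB.1, by
      filter_upwards [hA.2, hB.2] with i h1 h2
      rw [union_sdiff_distrib]
      exact measure_union_null h1 h2⟩)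
  let S : Set Y := ⋂ n, (A₀ n ∪ A₁ n)ᶜ
  have hmS : ∀ n, MeasurableSet (A₀ n ∪ A₁ n)ᶜ := fun n => ((hA₀ n).1.union (hA₁ n).1).compl
  have hS : MeasurableSet S := MeasurableSet.iInter hmS
  have hS0 : ν S ≠ 0 := fun h0 => by
    have hlim := tendsto_measure_iInter_atTop (μ := ν) (fun n => (hmS n).nullMeasurableSet)
      (fun m n hmn => compl_subset_compl.2 (union_subset_union (mono₀ hmn) (mono₁ hmn)))
      ⟨0, measure_ne_top _ _⟩
    rw [show ν (⋂ n, (A₀ n ∪ A₁ n)ᶜ) = 0 from h0] at hlim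
    obtain ⟨n, hn⟩ := (hlim.eventually (gt_mem_nhds (pos_iff_ne_zero.2 hε))).exists
    exact hsmall _ (finitelyBracketed_of_null ν ε C hC (A₀ n) (A₁ n) (hA₀ n).1 (hA₁ n).1 hn.le)
      ((hA₀ n).2.and (hA₁ n).2)
  have hS₀ : ∀ B ⊆ S, B \ ⋃ n, A₀ n = B := fun B hB => by
    refine sdiff_eq_left.2 (disjoint_iUnion_right.2 fun n => ?_)
    exact disjoint_left.2 fun y hy hy' => (mem_iInter.1 (hB hy) n) (Or.inl hy')
  have hS₁ : ∀ B ⊆ S, B \ ⋃ n, A₁ n = B := fun B hB => by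
    refine sdiff_eq_left.2 (disjoint_iUnion_right.2 fun n => ?_)
    exact disjoint_left.2 fun y hy hy' => (mem_iInter.1 (hB hy) n) (Or.inr hy')
  have hsplit : ∀ B ⊆ S, MeasurableSet B → ν B ≠ 0 →
      ∀ᶠ i in (𝓤 : Filter ι), ν (C i ∩ B) ≠ 0 ∧ ν (B \ C i) ≠ 0 := by
    intro B hB hBm hB0
    refine Filter.Eventually.and (Ultrafilter.eventually_not.2 fun h => hB0 ?_)
      (Ultrafilter.eventually_not.2 fun h => hB0 ?_)
    · rw [← hS₀ B hB]; exact ex₀ B ⟨hBm, h⟩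
    · rw [← hS₁ B hB]; exact ex₁ B ⟨hBm, h⟩
  refine hdim.ne (vcDim_eq_top_of_independent 𝒞 C hC𝒞 fun m => ?_)
  obtain ⟨c, hc⟩ := exists_independent_of_split ν C hC 𝓤 S hS hS0 hsplit m
  refine ⟨c, fun σ => ?_⟩
  obtain ⟨y, hy⟩ := nonempty_of_measure_ne_zero (hc σ)
  exact ⟨y, hy.2⟩

theorem measurableSet_graph {X : Type*} [MeasurableSpace X] {f : X → ℝ} (hf : Measurable f) :
    MeasurableSet (graph f) :=
  ((measurableSet_le measurable_const measurable_snd).inter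
    (measurableSet_le measurable_snd (hf.comp measurable_fst))).union
    ((measurableSet_le (hf.comp measurable_fst) measurable_snd).inter
    (measurableSet_le measurable_snd measurable_const))

/-- The region between the graphs of `-G` and `G`. -/
def envelopeRegion {X : Type*} (G : X → ℝ) : Set (X × ℝ) :=
  {p | |p.2| ≤ G p.1}

theorem measurableSet_envelopeRegion {X : Type*} [MeasurableSpace X] {G : X → ℝ}
    (hG : Measurable G) : MeasurableSet (envelopeRegion G) :=
  measurableSet_le (continuous_abs.measurable.comp measurable_snd) (hG.comp measurable_fst)

theorem graph_subset_envelopeRegion {X : Type*} {f G : X → ℝ} (h : ∀ x, |f x| ≤ G x) :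
    graph f ⊆ envelopeRegion G := by
  rintro ⟨x, s⟩ hp
  have hx := abs_le.1 (h x)
  change |s| ≤ G x
  rcases hp with hp | hp <;> exact abs_le.2 ⟨by linarith [hp.1, hp.2], by linarith [hp.1, hp.2]⟩

/-- The length of the part of the fibre of `S` over `x` above the horizontal axis. -/
noncomputable def upperLength {X : Type*} (S : Set (X × ℝ)) (x : X) : ℝ≥0∞ :=
  volume (Prod.mk x ⁻¹' (S ∩ {p | 0 ≤ p.2}))

/-- The length of the part of the fibre of `S` over `x` below the horizontal axis. -/
noncomputable def lowerLength {X : Type*} (S : Set (X × ℝ)) (x : X) : ℝ≥0∞ :=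
  volume (Prod.mk x ⁻¹' (S ∩ {p | p.2 < 0}))

theorem measurable_upperLength {X : Type*} [MeasurableSpace X] {S : Set (X × ℝ)}
    (hS : MeasurableSet S) : Measurable (upperLength S) :=
  measurable_measure_prodMk_left (hS.inter (measurableSet_le measurable_const measurable_snd))

theorem measurable_lowerLength {X : Type*} [MeasurableSpace X] {S : Set (X × ℝ)}
    (hS : MeasurableSet S) : Measurable (lowerLength S) :=
  measurable_measure_prodMk_left (hS.inter (measurableSet_lt measurable_snd measurable_const))

theorem upperLength_mono {X : Type*} {S T : Set (X × ℝ)} (h : S ⊆ T) (x : X) :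
    upperLength S x ≤ upperLength T x :=
  measure_mono (preimage_mono (inter_subset_inter_left _ h))

theorem lowerLength_mono {X : Type*} {S T : Set (X × ℝ)} (h : S ⊆ T) (x : X) :
    lowerLength S x ≤ lowerLength T x :=
  measure_mono (preimage_mono (inter_subset_inter_left _ h))

theorem upperLength_ne_top {X : Type*} {S : Set (X × ℝ)} {G : X → ℝ} (h : S ⊆ envelopeRegion G)
    (x : X) : upperLength S x ≠ ∞ := by
  refine ne_top_of_le_ne_top (measure_Icc_lt_top (μ := volume) (a := -G x) (b := G x)).ne
    (measure_mono fun s hs => ?_)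
  exact abs_le.1 (h hs.1)

theorem lowerLength_ne_top {X : Type*} {S : Set (X × ℝ)} {G : X → ℝ} (h : S ⊆ envelopeRegion G)
    (x : X) : lowerLength S x ≠ ∞ := by
  refine ne_top_of_le_ne_top (measure_Icc_lt_top (μ := volume) (a := -G x) (b := G x)).ne
    (measure_mono fun s hs => ?_)
  exact abs_le.1 (h hs.1)

theorem upperLength_graph {X : Type*} (f : X → ℝ) (x : X) :
    upperLength (graph f) x = ENNReal.ofReal (max (f x) 0) := by
  have : Prod.mk x ⁻¹' (graph f ∩ {p | 0 ≤ p.2}) = Icc 0 (max (f x) 0) := by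
    ext s
    simp only [graph, mem_preimage, mem_inter_iff, mem_ofPred_eq, mem_Icc, le_max_iff]
    grind
  rw [upperLength, this, Real.volume_Icc, sub_zero]

theorem lowerLength_graph {X : Type*} (f : X → ℝ) (x : X) :
    lowerLength (graph f) x = ENNReal.ofReal (max (-f x) 0) := by
  have : Prod.mk x ⁻¹' (graph f ∩ {p | p.2 < 0}) = Ico (-max (-f x) 0) 0 := by
    ext s
    simp only [graph, mem_preimage, mem_inter_iff, mem_ofPred_eq, mem_Ico]
    grind
  rw [lowerLength, this, Real.volume_Ico, zero_sub, neg_neg]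

/-- The difference between the length of the fibre of `S` above the axis and that of the fibre
of `T` below the axis. -/
noncomputable def signedLength {X : Type*} (S T : Set (X × ℝ)) (x : X) : ℝ :=
  (upperLength S x).toReal - (lowerLength T x).toReal

theorem signedLength_graph {X : Type*} (f : X → ℝ) (x : X) :
    signedLength (graph f) (graph f) x = f x := by
  rw [signedLength, upperLength_graph, lowerLength_graph,
    ENNReal.toReal_ofReal (le_max_right _ _), ENNReal.toReal_ofReal (le_max_right _ _)]
  grind

theorem measurable_signedLength {X : Type*} [MeasurableSpace X] {S T : Set (X × ℝ)}
    (hS : MeasurableSet S) (hT : MeasurableSet T) : Measurable (signedLength S T) :=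
  (measurable_upperLength hS).ennreal_toReal.sub (measurable_lowerLength hT).ennreal_toReal

theorem signedLength_le {X : Type*} {S S' T T' : Set (X × ℝ)} {G : X → ℝ}
    (hS : S ⊆ S') (hT : T' ⊆ T) (hS' : S' ⊆ envelopeRegion G)
    (hT' : T ⊆ envelopeRegion G) (x : X) :
    signedLength S T x ≤ signedLength S' T' x :=
  sub_le_sub (ENNReal.toReal_mono (upperLength_ne_top hS' x) (upperLength_mono hS x))
    (ENNReal.toReal_mono (lowerLength_ne_top hT' x) (lowerLength_mono hT x))

theorem ofReal_signedLength_sub {X : Type*} [MeasurableSpace X] {L U : Set (X × ℝ)} {G : X → ℝ}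
    (hL : MeasurableSet L) (hLU : L ⊆ U) (hU : U ⊆ envelopeRegion G) (x : X) :
    ENNReal.ofReal (signedLength U L x - signedLength L U x) ≤
      volume (Prod.mk x ⁻¹' (U \ L)) := by
  have h1 := upperLength_ne_top (hLU.trans hU) x
  have h2 := lowerLength_ne_top (hLU.trans hU) x
  have e1 : upperLength (U \ L) x = upperLength U x - upperLength L x := by
    rw [upperLength, upperLength, upperLength, ← measure_sdiff _ _ h1]
    · congr 1
      ext s
      simp only [mem_preimage, mem_inter_iff, Set.mem_sdiff]
      tauto
    · exact preimage_mono (inter_subset_inter_left _ hLU)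
    · exact (measurable_prodMk_left (hL.inter
        (measurableSet_le measurable_const measurable_snd))).nullMeasurableSet
  have e2 : lowerLength (U \ L) x = lowerLength U x - lowerLength L x := by
    rw [lowerLength, lowerLength, lowerLength, ← measure_sdiff _ _ h2]
    · congr 1
      ext s
      simp only [mem_preimage, mem_inter_iff, Set.mem_sdiff]
      tauto
    · exact preimage_mono (inter_subset_inter_left _ hLU)
    · exact (measurable_prodMk_left (hL.inter
        (measurableSet_lt measurable_snd measurable_const))).nullMeasurableSet
  have e3 : upperLength (U \ L) x + lowerLength (U \ L) x = volume (Prod.mk x ⁻¹' (U \ L)) := by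
    rw [← measure_inter_add_sdiff (Prod.mk x ⁻¹' (U \ L)) (measurableSet_Ici (a := (0 : ℝ))),
      upperLength, lowerLength]
    congr 2
    ext s
    simp
  have d1 : (upperLength (U \ L) x).toReal = (upperLength U x).toReal - (upperLength L x).toReal := by
    rw [e1, ENNReal.toReal_sub_of_le (upperLength_mono hLU x) (upperLength_ne_top hU x)]
  have d2 : (lowerLength (U \ L) x).toReal = (lowerLength U x).toReal - (lowerLength L x).toReal := by
    rw [e2, ENNReal.toReal_sub_of_le (lowerLength_mono hLU x) (lowerLength_ne_top hU x)]
  have d3 : signedLength U L x - signedLength L U x =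
      (upperLength (U \ L) x + lowerLength (U \ L) x).toReal := by
    rw [ENNReal.toReal_add (upperLength_ne_top (sdiff_subset.trans hU) x)
      (lowerLength_ne_top (sdiff_subset.trans hU) x), d1, d2, signedLength, signedLength]
    ring
  rw [d3, e3]
  exact ENNReal.ofReal_toReal_le

/-- A bracket around graphs of functions yields a bracket around the functions. -/
theorem isEpsBracket_signedLength {X : Type*} [MeasurableSpace X] (μ : Measure X) {ε : ℝ}
    {L U : Set (X × ℝ)} {G : X → ℝ} (hL : MeasurableSet L) (hU : MeasurableSet U) (hLU : L ⊆ U)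
    (hUG : U ⊆ envelopeRegion G) (hε : μ.prod volume (U \ L) ≤ ENNReal.ofReal ε) :
    IsEpsBracket μ ε (signedLength L U) (signedLength U L) where
  measurable_left := measurable_signedLength hL hU
  measurable_right := measurable_signedLength hU hL
  le := signedLength_le hLU hLU hUG hUG
  lintegral_le := by
    refine (lintegral_mono fun x => ofReal_signedLength_sub hL hLU hUG x).trans ?_
    rwa [← Measure.prod_apply (hU.diff hL)]

theorem prod_volume_envelopeRegion_lt_top {X : Type*} [MeasurableSpace X] (μ : Measure X)
    {G : X → ℝ} (hG : Measurable G) (hint : Integrable G μ) :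
    μ.prod volume (envelopeRegion G) < ∞ := by
  rw [Measure.prod_apply (measurableSet_envelopeRegion hG)]
  have : ∀ x, volume (Prod.mk x ⁻¹' envelopeRegion G) = ENNReal.ofReal (2 * G x) := fun x => by
    rw [show Prod.mk x ⁻¹' envelopeRegion G = Icc (-G x) (G x) from
      ext fun s => (abs_le (a := s) (b := G x)), Real.volume_Icc]
    congr 1
    ring
  simp_rw [this]
  exact (hint.const_mul 2).lintegral_lt_top

/-- Finitely many brackets covering a family also cover its pointwise sequential limits. -/
theorem IsBracketCover.of_tendsto {X : Type*} [MeasurableSpace X] {μ : Measure X} {ε : ℝ}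
    {F₀ F : Set (X → ℝ)} {Θ : Set ((X → ℝ) × (X → ℝ))} (hΘ : Θ.Finite)
    (h : IsBracketCover μ ε F₀ Θ) (hF : ∀ f ∈ F, Measurable f)
    (hlim : ∀ f ∈ F, ∃ u : ℕ → X → ℝ, (∀ n, u n ∈ F₀) ∧
      ∀ x, Tendsto (fun n => u n x) atTop (nhds (f x))) :
    IsBracketCover μ ε F Θ := by
  refine ⟨h.1, fun f hf => ?_⟩
  obtain ⟨u, hu, hux⟩ := hlim f hf
  have hfreq : ∃ p ∈ Θ, ∃ᶠ n in atTop, u n ∈ bracket p.1 p.2 := by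
    by_contra! hcon
    have hev : ∀ᶠ n in atTop, ∀ p ∈ Θ, u n ∉ bracket p.1 p.2 :=
      (eventually_all_finite hΘ).2 fun p hp => hcon p hp
    obtain ⟨n, hn⟩ := hev.exists
    obtain ⟨p, hp, hpn⟩ := h.2 (u n) (hu n)
    exact hn p hp hpn
  obtain ⟨p, hp, hfr⟩ := hfreq
  refine ⟨p, hp, hF f hf, fun x => ⟨?_, ?_⟩⟩
  · exact ge_of_tendsto_of_frequently (hux x) (hfr.mono fun n hn => (hn.2 x).1)
  · exact le_of_tendsto_of_frequently (hux x) (hfr.mono fun n hn => (hn.2 x).2)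

theorem bracketingNumber_lt_top {X : Type*} [MeasurableSpace X] {μ : Measure X} {ε : ℝ}
    {F : Set (X → ℝ)} {Θ : Set ((X → ℝ) × (X → ℝ))} (hΘ : Θ.Finite)
    (h : IsBracketCover μ ε F Θ) : bracketingNumber ε F μ < ⊤ :=
  (iInf₂_le Θ h).trans_lt hΘ.encard_lt_top

end VCGraph

theorem proposition2 {X : Type*} [MeasurableSpace X]
    (F : Set (X → ℝ)) (hF : ∀ f ∈ F, Measurable f)
    (hsep : VCGraph.IsSeparableFamily F)
    (hdim : VCGraph.vcDim (VCGraph.graphs F) < ⊤)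
    (G : X → ℝ) (hG : VCGraph.IsEnvelope G F)
    (μ : MeasureTheory.Measure X) [MeasureTheory.IsProbabilityMeasure μ]
    (hint : MeasureTheory.Integrable G μ)
    (ε : ℝ) (hε : 0 < ε) :
    VCGraph.bracketingNumber ε F μ < ⊤ := by
  open VCGraph MeasureTheory in
  obtain ⟨F₀, hF₀, hcount, hlim⟩ := hsep
  have : Countable F₀ := hcount.to_subtype
  have hR := measurableSet_envelopeRegion hG.measurable
  have : IsFiniteMeasure ((μ.prod volume).restrict (envelopeRegion G)) :=
    ⟨by simpa using prod_volume_envelopeRegion_lt_top μ hG.measurable hint⟩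
  obtain ⟨T, hT, hT1, hT2⟩ := finitelyBracketed_of_vcDim_lt_top
    ((μ.prod volume).restrict (envelopeRegion G)) (ENNReal.ofReal ε)
    (ENNReal.ofReal_pos.2 hε).ne' (fun f : F₀ => graph f.1)
    (fun f => measurableSet_graph (hF _ (hF₀ f.2))) (graphs F)
    (fun f => ⟨f.1, hF₀ f.2, rfl⟩) hdim
  let b : Set (X × ℝ) × Set (X × ℝ) → (X → ℝ) × (X → ℝ) := fun p =>
    (signedLength (p.1 ∩ envelopeRegion G) (p.2 ∩ envelopeRegion G),
      signedLength (p.2 ∩ envelopeRegion G) (p.1 ∩ envelopeRegion G))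
  have hcover : IsBracketCover μ ε F₀ (b '' T) := by
    constructor
    · rintro _ ⟨p, hp, rfl⟩
      obtain ⟨h1, h2, h12, hpε⟩ := hT1 p hp
      refine isEpsBracket_signedLength μ (h1.inter hR) (h2.inter hR)
        (Set.inter_subset_inter_left _ h12) Set.inter_subset_right ?_
      rw [Measure.restrict_apply (h2.diff h1)] at hpε
      rwa [← Set.inter_sdiff_distrib_right]
    · intro f hf
      obtain ⟨p, hp, hpL, hpU⟩ := hT2 ⟨f, hf⟩ (Set.mem_univ _)
      have hgR := graph_subset_envelopeRegion (hG.abs_le f (hF₀ hf))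
      have hL : p.1 ∩ envelopeRegion G ⊆ graph f := Set.inter_subset_left.trans hpL
      have hU : graph f ⊆ p.2 ∩ envelopeRegion G := Set.subset_inter hpU hgR
      refine ⟨b p, ⟨p, hp, rfl⟩, hF f (hF₀ hf), fun x => ?_⟩
      have := signedLength_graph f x
      constructor
      · exact (signedLength_le hL hU hgR Set.inter_subset_right x).trans_eq this
      · exact this.symm.trans_le (signedLength_le hU hL Set.inter_subset_right hgR x)
  exact bracketingNumber_lt_top (hT.image b) (hcover.of_tendsto (hT.image b) hF hlim)
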